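/- Let $n\in\mathbb{N}$. There is a constant $k(n)\ge 1$, depending only on $n$, with the following property. Let $C\subset\mathbb{R}^n$ be a compact (not necessarily convex) set, let $f:C\to\mathbb{R}$ be an arbitrary function, and let $G:C\to\mathbb{R}^n$ be a continuous mapping. Then there exists a convex function $F:\mathbb{R}^n\to\mathbb{R}$ of class $C^1$ such that $F=f$ and $\nabla F=G$ on $C$ if and only if the pair $(f,G)$ satisfies both conditions $$f(x)-f(y)\ge\langle G(y),x-y\rangle\quad\text{for all }x,y\in C,\qquad (C)$$ $$f(x)-f(y)=\langle G(y),x-y\rangle\implies G(x)=G(y)\quad\text{for all }x,y\in C.\qquad (CW^1)$$ Moreover, whenever $(C)$ and $(CW^1)$ hold, such an $F$ can be chosen with $$\mathrm{Lip}(F)\le k(n)\,\sup_{y\in C}|G(y)|,$$ where $\mathrm{Lip}(F)=\sup_{x\in\mathbb{R}^n}|\nabla F(x)|$ is the (Euclidean) Lipschitz constant of $F$, and the supremum on the right is $0$ if $C=\emptyset$. -/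

import Mathlib

open scoped NNReal

/-- Condition `(C)`: `f x - f y ≥ ⟨G y, x - y⟩` for all `x, y ∈ C`. -/
def CondC {n : ℕ} {C : Set (EuclideanSpace ℝ (Fin n))} (f : C → ℝ)
    (G : C → EuclideanSpace ℝ (Fin n)) : Prop :=
  ∀ x y : C, f x - f y ≥ inner ℝ (G y) ((x : EuclideanSpace ℝ (Fin n)) - y)

/-- Condition `(CW¹)`: `f x - f y = ⟨G y, x - y⟩` implies `G x = G y`, for all `x, y ∈ C`. -/
def CondCW1 {n : ℕ} {C : Set (EuclideanSpace ℝ (Fin n))} (f : C → ℝ)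
    (G : C → EuclideanSpace ℝ (Fin n)) : Prop :=
  ∀ x y : C, f x - f y = inner ℝ (G y) ((x : EuclideanSpace ℝ (Fin n)) - y) → G x = G y

/-- `F` is a convex function of class `C¹` on the whole of `ℝⁿ`, with `F = f` and `∇F = G`
on `C`. -/
structure IsConvexC1Extension {n : ℕ} {C : Set (EuclideanSpace ℝ (Fin n))} (f : C → ℝ)
    (G : C → EuclideanSpace ℝ (Fin n)) (F : EuclideanSpace ℝ (Fin n) → ℝ) : Prop where
  convexOn : ConvexOn ℝ Set.univ F
  contDiff : ContDiff ℝ 1 F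
  eq_on : ∀ y : C, F y = f y
  hasGradientAt : ∀ y : C, HasGradientAt F (G y) (y : EuclideanSpace ℝ (Fin n))

/-! Necessity: a convex `F` lies above its tangents, and if it touches the tangent at `y` in `x`,
then `F` minus the linear part of that tangent is minimal at `x`, so the gradients agree.
Sufficiency: let `g` be the infimum over `y ∈ C` of the prescribed tangent at `y` plus a barrier `Φ
(x - y)`, and let `F` be the largest convex minorant of `g`. The barrier keeps every prescribed
tangent below `g` (`exists_barrier`), hence below `F`, while `Φ 0 = 0` gives `F ≤ f` on `C`.
One-sided bounds on second differences survive infima and convex minorants, and for a convex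
function they force `C¹` (`UniformlySmooth.contDiff`). The estimates are dimension-free: the
tangents contribute `M` and the barrier `20 * M`, so `k = 21` works. -/

open Filter Topology

/-! ### Convex minorants and second differences -/

section ConvexMinorant

variable {E : Type*} [NormedAddCommGroup E] [InnerProductSpace ℝ E]

/-- The second differences of `g` are `o(‖h‖)`, from above and uniformly in the base point. -/
def UniformlySmooth (g : E → ℝ) : Prop :=
  ∀ ε > 0, ∃ δ > 0, ∀ x h : E, ‖h‖ ≤ δ → g (x + h) + g (x - h) - 2 * g x ≤ ε * ‖h‖

/-- The largest convex minorant of `g` (a junk value where `g` has none). -/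
noncomputable def convexMinorant (g : E → ℝ) (x : E) : ℝ :=
  ⨆ u : {u : E → ℝ // ConvexOn ℝ Set.univ u ∧ ∀ z, u z ≤ g z}, u.1 x

theorem le_convexMinorant {g u : E → ℝ} (hu : ConvexOn ℝ Set.univ u) (hug : ∀ z, u z ≤ g z)
    (x : E) : u x ≤ convexMinorant g x :=
  le_ciSup (f := fun u : {u : E → ℝ // ConvexOn ℝ Set.univ u ∧ ∀ z, u z ≤ g z} ↦ u.1 x)
    ⟨g x, by rintro _ ⟨v, rfl⟩; exact v.2.2 x⟩ ⟨u, hu, hug⟩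

theorem convexMinorant_le {g u : E → ℝ} (hu : ConvexOn ℝ Set.univ u) (hug : ∀ z, u z ≤ g z)
    (x : E) : convexMinorant g x ≤ g x :=
  have : Nonempty {u : E → ℝ // ConvexOn ℝ Set.univ u ∧ ∀ z, u z ≤ g z} := ⟨⟨u, hu, hug⟩⟩
  ciSup_le fun v ↦ v.2.2 x

theorem convexOn_convexMinorant {g u : E → ℝ} (hu : ConvexOn ℝ Set.univ u)
    (hug : ∀ z, u z ≤ g z) : ConvexOn ℝ Set.univ (convexMinorant g) := by
  have : Nonempty {u : E → ℝ // ConvexOn ℝ Set.univ u ∧ ∀ z, u z ≤ g z} := ⟨⟨u, hu, hug⟩⟩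
  refine ⟨convex_univ, fun x _ y _ a b ha hb hab ↦ ciSup_le fun v ↦ ?_⟩
  refine (v.2.1.2 (Set.mem_univ x) (Set.mem_univ y) ha hb hab).trans ?_
  have h₁ := mul_le_mul_of_nonneg_left (le_convexMinorant v.2.1 v.2.2 x) ha
  have h₂ := mul_le_mul_of_nonneg_left (le_convexMinorant v.2.1 v.2.2 y) hb
  simpa only [smul_eq_mul] using add_le_add h₁ h₂

/-- Averaging the minorant over `z ± h` and lowering it by `ε * ‖h‖ / 2` gives a convex function
still below `g`, so maximality applies. -/
theorem UniformlySmooth.convexMinorant {g u : E → ℝ} (hg : UniformlySmooth g)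
    (hu : ConvexOn ℝ Set.univ u) (hug : ∀ z, u z ≤ g z) :
    UniformlySmooth (convexMinorant g) := by
  intro ε hε
  obtain ⟨δ, hδ, H⟩ := hg ε hε
  refine ⟨δ, hδ, fun x h hh ↦ ?_⟩
  have hF := convexOn_convexMinorant hu hug
  have hF₁ : ConvexOn ℝ Set.univ fun z ↦ _root_.convexMinorant g (z + h) := by
    simpa [Function.comp_def] using hF.translate_left h
  have hF₂ : ConvexOn ℝ Set.univ fun z ↦ _root_.convexMinorant g (z - h) := by
    simpa [Function.comp_def, sub_eq_add_neg] using hF.translate_left (-h)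
  have hv := ((hF₁.add hF₂).smul (c := (1 / 2 : ℝ)) (by norm_num)).add_const (-(ε * ‖h‖ / 2))
  have := le_convexMinorant (g := g) hv (fun z ↦ ?_) x
  · simp only [Pi.add_apply, smul_eq_mul] at this
    linarith
  · have h₁ := convexMinorant_le hu hug (z + h)
    have h₂ := convexMinorant_le hu hug (z - h)
    have h₃ := H z h hh
    simp only [Pi.add_apply, smul_eq_mul]
    linarith

theorem convexMinorant_le_add {g u : E → ℝ} {L : ℝ} (hg : ∀ x y, g x ≤ g y + L * ‖x - y‖)
    (hu : ConvexOn ℝ Set.univ u) (hug : ∀ z, u z ≤ g z) (x y : E) :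
    convexMinorant g x ≤ convexMinorant g y + L * ‖x - y‖ := by
  have hF : ConvexOn ℝ Set.univ fun z ↦ _root_.convexMinorant g (z + (x - y)) := by
    simpa [Function.comp_def] using (convexOn_convexMinorant hu hug).translate_left (x - y)
  have := le_convexMinorant (g := g) (hF.add_const (-(L * ‖x - y‖))) (fun z ↦ ?_) y
  · simp only [Pi.add_apply, add_sub_cancel] at this
    linarith
  · have h₁ := convexMinorant_le hu hug (z + (x - y))
    have h₂ := hg (z + (x - y)) z
    simp only [add_sub_cancel_left] at h₂
    simp only [Pi.add_apply]
    linarith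

theorem le_add_inner_of_second_difference_le {F : E → ℝ} {v x : E} {ε : ℝ} {h : E}
    (hlow : ∀ z, F x + inner ℝ v (z - x) ≤ F z)
    (H : F (x + h) + F (x - h) - 2 * F x ≤ ε * ‖h‖) :
    F (x + h) ≤ F x + inner ℝ v h + ε * ‖h‖ := by
  have := hlow (x - h)
  rw [sub_sub_cancel_left, inner_neg_right] at this
  linarith

end ConvexMinorant

/-! ### Subgradients, gradients and continuous differentiability -/

section Differentiability

variable {E : Type*} [NormedAddCommGroup E] [InnerProductSpace ℝ E] [CompleteSpace E]

theorem ConvexOn.exists_subgradient {F : E → ℝ} (hF : ConvexOn ℝ Set.univ F) (hc : Continuous F)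
    (x : E) : ∃ v : E, ∀ z, F x + inner ℝ v (z - x) ≤ F z := by
  have hconv : Convex ℝ {p : E × ℝ | F p.1 < p.2} := by
    simpa using hF.convex_strict_epigraph
  have hopen : IsOpen {p : E × ℝ | F p.1 < p.2} :=
    isOpen_lt (hc.comp continuous_fst) continuous_snd
  obtain ⟨L, hL⟩ := geometric_hahn_banach_open_point hconv hopen
    (x := (x, F x)) (by simp)
  have hdec (p : E) (t : ℝ) : L (p, t) = L (p, 0) + t * L (0, 1) := by
    rw [← smul_eq_mul, ← map_smul, ← map_add]
    simp
  set c := L (0, 1) with hcdef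
  -- The separating hyperplane is not vertical, so dividing by `-c` turns it into the graph of an
  -- affine minorant.
  have hneg : c < 0 := by
    have := hL (x, F x + 1) (by simp)
    rw [hdec x (F x + 1), hdec x (F x)] at this
    linarith
  have hle (z : E) : L (z, 0) + F z * c ≤ L (x, 0) + F x * c := by
    refine le_of_forall_pos_le_add fun ε hε ↦ ?_
    have := hL (z, F z + ε / (-c)) (by simpa using div_pos hε (neg_pos.2 hneg))
    rw [hdec z, hdec x (F x), add_mul] at this
    have h₂ : ε / (-c) * c = -ε := by rw [div_neg, neg_mul, div_mul_cancel₀ _ hneg.ne]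
    linarith
  let l : E →L[ℝ] ℝ := (-c)⁻¹ • L.comp (ContinuousLinearMap.inl ℝ E ℝ)
  refine ⟨(InnerProductSpace.toDual ℝ E).symm l, fun z ↦ ?_⟩
  rw [InnerProductSpace.toDual_symm_apply]
  have h₁ : l (z - x) = (-c)⁻¹ * (L (z, 0) - L (x, 0)) := by
    simp [l, ← map_sub]
  rw [h₁]
  have h₂ : (-c)⁻¹ * (L (z, 0) - L (x, 0)) ≤ (-c)⁻¹ * ((-c) * (F z - F x)) :=
    mul_le_mul_of_nonneg_left (by linarith [hle z]) (inv_pos.2 (neg_pos.2 hneg)).le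
  rw [inv_mul_cancel_left₀ (neg_pos.2 hneg).ne'] at h₂
  linarith

theorem hasGradientAt_of_sandwich {F : E → ℝ} {v x : E}
    (hlow : ∀ z, F x + inner ℝ v (z - x) ≤ F z)
    (hup : ∀ ε > 0, ∃ δ > 0, ∀ h, ‖h‖ ≤ δ → F (x + h) ≤ F x + inner ℝ v h + ε * ‖h‖) :
    HasGradientAt F v x := by
  rw [hasGradientAt_iff_isLittleO, Asymptotics.isLittleO_iff]
  intro ε hε
  obtain ⟨δ, hδ, H⟩ := hup ε hε
  filter_upwards [Metric.ball_mem_nhds x hδ] with z hz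
  have h₁ := H (z - x) (by rw [← dist_eq_norm]; exact (Metric.mem_ball.1 hz).le)
  rw [add_sub_cancel] at h₁
  rw [Real.norm_eq_abs, abs_le]
  constructor
  · nlinarith [hlow z, norm_nonneg (z - x)]
  · linarith

theorem UniformlySmooth.contDiff {F : E → ℝ} (hs : UniformlySmooth F)
    (hF : ConvexOn ℝ Set.univ F) (hc : Continuous F) : ContDiff ℝ 1 F := by
  choose v hv using hF.exists_subgradient hc
  have hgrad (x : E) : HasGradientAt F (v x) x := by
    refine hasGradientAt_of_sandwich (hv x) fun ε hε ↦ ?_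
    obtain ⟨δ, hδ, H⟩ := hs ε hε
    exact ⟨δ, hδ, fun h hh ↦ le_add_inner_of_second_difference_le (hv x) (H x h hh)⟩
  have hcont : Continuous v := by
    rw [Metric.continuous_iff]
    intro x ε hε
    obtain ⟨δ, hδ, H⟩ := hs (ε / 4) (by positivity)
    refine ⟨δ / 2, by positivity, fun y hy ↦ ?_⟩
    rw [dist_eq_norm] at hy ⊢
    set w := v y - v x with hw
    rcases eq_or_ne w 0 with h0 | h0
    · simpa [h0] using hε
    have hwpos : 0 < ‖w‖ := norm_pos_iff.2 h0
    -- Moving from `y` in the direction of the gradient difference makes the tangent at `y` outgrow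
    -- the upper bound at `x` unless `w` is small.
    set d : E := (δ / 2 / ‖w‖) • w with hd
    have hdn : ‖d‖ = δ / 2 := by
      rw [hd, norm_smul, Real.norm_of_nonneg (by positivity), div_mul_cancel₀ _ hwpos.ne']
    have hdist : ‖y - x + d‖ ≤ δ := by linarith [norm_add_le (y - x) d]
    have h₁ := le_add_inner_of_second_difference_le (hv x) (H x (y - x + d) hdist)
    have h₂ := hv y (y + d)
    have h₃ := hv x y
    rw [add_sub_cancel_left] at h₂
    rw [show x + (y - x + d) = y + d by abel, inner_add_right] at h₁
    have h₄ : inner ℝ w d = δ / 2 * ‖w‖ := by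
      rw [hd, inner_smul_right, real_inner_self_eq_norm_sq]
      field_simp
    rw [hw, inner_sub_left, ← hw] at h₄
    have h₅ : ε / 4 * ‖y - x + d‖ ≤ ε / 4 * δ := by gcongr
    have h₆ : δ * ‖w‖ ≤ δ * (ε / 2) := by linarith
    have := le_of_mul_le_mul_left h₆ hδ
    linarith
  rw [contDiff_one_iff_hasFDerivAt]
  exact ⟨fun x ↦ InnerProductSpace.toDual ℝ E (v x),
    (InnerProductSpace.toDual ℝ E).continuous.comp hcont, fun x ↦ (hgrad x).hasFDerivAt⟩

/-- The gradient inequality for a convex function differentiable at `x`. -/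
theorem ConvexOn.add_inner_le_of_hasGradientAt {F : E → ℝ} (hF : ConvexOn ℝ Set.univ F) {v x : E}
    (hv : HasGradientAt F v x) (z : E) : F x + inner ℝ v (z - x) ≤ F z := by
  have hline : ConvexOn ℝ Set.univ (F ∘ AffineMap.lineMap (k := ℝ) x z) := by
    simpa using hF.comp_affineMap (AffineMap.lineMap x z)
  have hder : HasDerivAt (F ∘ AffineMap.lineMap (k := ℝ) x z) (inner ℝ v (z - x)) 0 := by
    have h₁ : HasFDerivAt F (InnerProductSpace.toDual ℝ E v)
        (AffineMap.lineMap (k := ℝ) x z 0) := by simpa using hv.hasFDerivAt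
    simpa using h₁.comp_hasDerivAt (0 : ℝ) (AffineMap.hasDerivAt_lineMap (a := x) (b := z))
  have := hline.le_slope_of_hasDerivAt (Set.mem_univ 0) (Set.mem_univ 1) one_pos hder
  simp [slope_def_field] at this
  linarith

/-- If a convex function touches its tangent hyperplane at `y` in a second point `x`, then its
gradients at the two points agree. -/
theorem ConvexOn.gradient_eq_of_eq_add_inner {F : E → ℝ} (hF : ConvexOn ℝ Set.univ F)
    {v w x y : E} (hx : HasGradientAt F v x) (hy : HasGradientAt F w y)
    (h : F x = F y + inner ℝ w (x - y)) : v = w := by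
  have hmin : IsLocalMin (fun z ↦ F z - InnerProductSpace.toDual ℝ E w z) x := by
    refine Eventually.of_forall fun z ↦ ?_
    have := hF.add_inner_le_of_hasGradientAt hy z
    simp only [InnerProductSpace.toDual_apply_apply]
    rw [inner_sub_right] at h this
    linarith
  have h0 := hmin.hasFDerivAt_eq_zero
    (hx.hasFDerivAt.sub (InnerProductSpace.toDual ℝ E w).hasFDerivAt)
  exact (InnerProductSpace.toDual ℝ E).injective (sub_eq_zero.1 h0)

end Differentiability

/-! ### Smoothed norms and their superpositions -/

section Barrier

variable {E : Type*} [NormedAddCommGroup E]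

/-- A smooth approximation of the norm at scale `δ`, vanishing at the origin. -/
noncomputable def softNorm (δ : ℝ) (x : E) : ℝ := √(‖x‖ ^ 2 + δ ^ 2) - δ

theorem softNorm_nonneg (δ : ℝ) (x : E) : 0 ≤ softNorm δ x :=
  sub_nonneg.2 (Real.le_sqrt_of_sq_le (by nlinarith [sq_nonneg ‖x‖]))

theorem softNorm_zero {δ : ℝ} (hδ : 0 < δ) : softNorm δ (0 : E) = 0 := by
  simp [softNorm, Real.sqrt_sq hδ.le]

theorem softNorm_le_add (δ : ℝ) (x y : E) : softNorm δ x ≤ softNorm δ y + ‖x - y‖ := by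
  have hS : ‖y‖ ≤ √(‖y‖ ^ 2 + δ ^ 2) := Real.le_sqrt_of_sq_le (by nlinarith [sq_nonneg δ])
  have hS2 : √(‖y‖ ^ 2 + δ ^ 2) ^ 2 = ‖y‖ ^ 2 + δ ^ 2 := Real.sq_sqrt (by positivity)
  have hxy : ‖x‖ ≤ ‖y‖ + ‖x - y‖ := norm_le_norm_add_norm_sub' x y
  have : √(‖x‖ ^ 2 + δ ^ 2) ≤ √(‖y‖ ^ 2 + δ ^ 2) + ‖x - y‖ := by
    refine Real.sqrt_le_iff.2 ⟨by positivity, ?_⟩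
    have h₁ : ‖x‖ ^ 2 ≤ (‖y‖ + ‖x - y‖) ^ 2 := by gcongr
    have h₂ := mul_le_mul_of_nonneg_right hS (norm_nonneg (x - y))
    nlinarith
  unfold softNorm
  linarith

theorem softNorm_le_norm {δ : ℝ} (hδ : 0 < δ) (x : E) : softNorm δ x ≤ ‖x‖ := by
  simpa [softNorm_zero hδ] using softNorm_le_add δ x 0

theorem norm_le_softNorm {δ : ℝ} (hδ : 0 < δ) {x : E} (hx : δ ≤ ‖x‖) :
    2 / 5 * ‖x‖ ≤ softNorm δ x := by
  have : 2 / 5 * ‖x‖ + δ ≤ √(‖x‖ ^ 2 + δ ^ 2) := Real.le_sqrt_of_sq_le (by nlinarith)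
  unfold softNorm
  linarith

/-- A superposition of smoothed norms at the scales `d k`. -/
noncomputable def softNormSum (d : ℕ → ℝ) (x : E) : ℝ := ∑' k, (1 / 2 : ℝ) ^ k * softNorm (d k) x

theorem summable_softNorm {d : ℕ → ℝ} (hd : ∀ k, 0 < d k) (x : E) :
    Summable fun k ↦ (1 / 2 : ℝ) ^ k * softNorm (d k) x :=
  Summable.of_nonneg_of_le (fun k ↦ mul_nonneg (by positivity) (softNorm_nonneg _ _))
    (fun k ↦ mul_le_mul_of_nonneg_left (softNorm_le_norm (hd k) x) (by positivity))
    (summable_geometric_two.mul_right ‖x‖)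

theorem softNormSum_zero {d : ℕ → ℝ} (hd : ∀ k, 0 < d k) : softNormSum d (0 : E) = 0 := by
  simp [softNormSum, softNorm_zero (hd _)]

theorem softNormSum_le_add {d : ℕ → ℝ} (hd : ∀ k, 0 < d k) (x y : E) :
    softNormSum d x ≤ softNormSum d y + 2 * ‖x - y‖ := by
  have h₁ : Summable fun k : ℕ ↦ (1 / 2 : ℝ) ^ k * ‖x - y‖ :=
    summable_geometric_two.mul_right ‖x - y‖
  have h₂ := (summable_softNorm hd x).tsum_le_tsum (g := fun k ↦
    (1 / 2 : ℝ) ^ k * softNorm (d k) y + (1 / 2 : ℝ) ^ k * ‖x - y‖) (fun k ↦ by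
      rw [← mul_add]
      exact mul_le_mul_of_nonneg_left (softNorm_le_add _ x y) (by positivity))
      ((summable_softNorm hd y).add h₁)
  rwa [(summable_softNorm hd y).tsum_add h₁, tsum_mul_right, tsum_geometric_two] at h₂

theorem norm_le_softNormSum {d : ℕ → ℝ} (hd : ∀ k, 0 < d k) {x : E} {N : ℕ} (hN : d N ≤ ‖x‖) :
    (1 / 2) ^ N * (2 / 5 * ‖x‖) ≤ softNormSum d x :=
  (mul_le_mul_of_nonneg_left (norm_le_softNorm (hd N) hN) (by positivity)).trans
    ((summable_softNorm hd x).le_tsum N fun k _ ↦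
      mul_nonneg (by positivity) (softNorm_nonneg _ _))

theorem UniformlySmooth.const_mul {g : E → ℝ} (hg : UniformlySmooth g) {c : ℝ} (hc : 0 ≤ c) :
    UniformlySmooth fun x ↦ c * g x := by
  intro ε hε
  obtain ⟨δ, hδ, H⟩ := hg (ε / (c + 1)) (by positivity)
  refine ⟨δ, hδ, fun x h hh ↦ ?_⟩
  calc c * g (x + h) + c * g (x - h) - 2 * (c * g x)
      = c * (g (x + h) + g (x - h) - 2 * g x) := by ring
    _ ≤ c * (ε / (c + 1) * ‖h‖) := mul_le_mul_of_nonneg_left (H x h hh) hc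
    _ = c / (c + 1) * (ε * ‖h‖) := by ring
    _ ≤ 1 * (ε * ‖h‖) := by
      gcongr
      rw [div_le_one (by positivity)]
      linarith
    _ = ε * ‖h‖ := one_mul _

variable [InnerProductSpace ℝ E]

theorem softNorm_second_difference_le {δ : ℝ} (hδ : 0 < δ) (x h : E) :
    softNorm δ (x + h) + softNorm δ (x - h) - 2 * softNorm δ x ≤ ‖h‖ * min 2 (‖h‖ / δ) := by
  rw [mul_min_of_nonneg _ _ (norm_nonneg h), le_min_iff]
  constructor
  · have h₁ := softNorm_le_add δ (x + h) x
    have h₂ := softNorm_le_add δ (x - h) x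
    rw [add_sub_cancel_left] at h₁
    rw [sub_sub_cancel_left, norm_neg] at h₂
    linarith
  · have hpar := parallelogram_law_with_norm ℝ x h
    set a := √(‖x + h‖ ^ 2 + δ ^ 2) with ha
    set b := √(‖x - h‖ ^ 2 + δ ^ 2) with hb
    set s := √(‖x‖ ^ 2 + δ ^ 2) with hs
    have ha2 : a ^ 2 = ‖x + h‖ ^ 2 + δ ^ 2 := Real.sq_sqrt (by positivity)
    have hb2 : b ^ 2 = ‖x - h‖ ^ 2 + δ ^ 2 := Real.sq_sqrt (by positivity)
    have hs2 : s ^ 2 = ‖x‖ ^ 2 + δ ^ 2 := Real.sq_sqrt (by positivity)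
    have hδs : δ ≤ s := Real.le_sqrt_of_sq_le (by nlinarith [sq_nonneg ‖x‖])
    have h₁ : (a + b) ^ 2 ≤ 4 * (s ^ 2 + ‖h‖ ^ 2) := by nlinarith [sq_nonneg (a - b)]
    have hq : 0 ≤ ‖h‖ ^ 2 / δ := by positivity
    have h₂ : ‖h‖ ^ 2 ≤ s * (‖h‖ ^ 2 / δ) := by
      calc ‖h‖ ^ 2 = δ * (‖h‖ ^ 2 / δ) := by field_simp
        _ ≤ s * (‖h‖ ^ 2 / δ) := by gcongr
    have h₃ : a + b ≤ 2 * s + ‖h‖ ^ 2 / δ :=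
      le_of_sq_le_sq (by nlinarith) (by positivity)
    have h₄ : ‖h‖ * (‖h‖ / δ) = ‖h‖ ^ 2 / δ := by ring
    unfold softNorm
    linarith

/-- The weights `2⁻ᵏ` allow dominated convergence, so the scales `d k` may shrink arbitrarily fast.
-/
theorem uniformlySmooth_softNormSum {d : ℕ → ℝ} (hd : ∀ k, 0 < d k) :
    UniformlySmooth (softNormSum d : E → ℝ) := by
  have hterm (t : ℝ) (ht : 0 ≤ t) (k : ℕ) :
      ‖(1 / 2 : ℝ) ^ k * min 2 (t / d k)‖ ≤ (1 / 2) ^ k * 2 := by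
    have := hd k
    rw [Real.norm_of_nonneg (by positivity)]
    exact mul_le_mul_of_nonneg_left (min_le_left _ _) (by positivity)
  have hsum2 : Summable fun k : ℕ ↦ (1 / 2 : ℝ) ^ k * 2 := summable_geometric_two.mul_right 2
  have hlim : Tendsto (fun t : ℝ ↦ ∑' k, (1 / 2 : ℝ) ^ k * min 2 (t / d k)) (𝓝[≥] 0)
      (𝓝 (∑' _ : ℕ, (0 : ℝ))) := by
    refine tendsto_tsum_of_dominated_convergence hsum2 (fun k ↦ ?_) ?_
    · have : Continuous fun t : ℝ ↦ (1 / 2 : ℝ) ^ k * min 2 (t / d k) := by fun_prop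
      simpa using (this.tendsto 0).mono_left nhdsWithin_le_nhds
    · filter_upwards [self_mem_nhdsWithin] with t ht k using hterm t ht k
  intro ε hε
  rw [tsum_zero] at hlim
  obtain ⟨δ, hδ, hball⟩ := Metric.mem_nhdsWithin_iff.1 (hlim.eventually_lt_const hε)
  refine ⟨δ / 2, by positivity, fun x h hh ↦ ?_⟩
  have hlt : ∑' k, (1 / 2 : ℝ) ^ k * min 2 (‖h‖ / d k) < ε :=
    hball (show ‖h‖ ∈ Metric.ball 0 δ ∩ Set.Ici 0 by
      refine ⟨?_, norm_nonneg h⟩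
      rw [mem_ball_zero_iff, norm_norm]
      linarith)
  have hs₁ := (summable_softNorm hd (x + h)).add (summable_softNorm hd (x - h))
  have hs₂ := (summable_softNorm hd x).mul_left 2
  have hle := (hs₁.sub hs₂).tsum_le_tsum
    (g := fun k ↦ ‖h‖ * ((1 / 2 : ℝ) ^ k * min 2 (‖h‖ / d k))) (fun k ↦ by
      have := mul_le_mul_of_nonneg_left (softNorm_second_difference_le (hd k) x h)
        (show (0 : ℝ) ≤ (1 / 2) ^ k by positivity)
      linarith)
    ((Summable.of_norm_bounded hsum2 (hterm ‖h‖ (norm_nonneg h))).mul_left _)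
  rw [hs₁.tsum_sub hs₂, (summable_softNorm hd (x + h)).tsum_add (summable_softNorm hd (x - h)),
    tsum_mul_left, tsum_mul_left] at hle
  refine hle.trans ?_
  rw [mul_comm ε]
  exact mul_le_mul_of_nonneg_left hlt.le (norm_nonneg h)

end Barrier

/-! ### Construction of the extension -/

section Extension

variable {E : Type*} [NormedAddCommGroup E] [InnerProductSpace ℝ E] {C : Set E} {f : C → ℝ}
  {G : C → E} {M : ℝ}

theorem continuous_of_subgradient_bounded (hM : ∀ y, ‖G y‖ ≤ M)
    (hf : ∀ x y : C, inner ℝ (G y) ((x : E) - y) ≤ f x - f y) : Continuous f := by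
  have hM' : ∀ y, ‖G y‖ ≤ M.toNNReal := fun y ↦ (hM y).trans (Real.le_coe_toNNReal M)
  refine (LipschitzWith.of_le_add_mul M.toNNReal fun x y ↦ ?_).continuous
  have h₁ := hf y x
  have h₂ := (neg_le_abs _).trans (abs_real_inner_le_norm (G x) ((y : E) - x))
  have h₃ := mul_le_mul_of_nonneg_right (hM' x) (norm_nonneg ((y : E) - x))
  rw [dist_comm, Subtype.dist_eq, dist_eq_norm]
  linarith

/-- By compactness, the gap in the subgradient inequality is bounded below wherever the
prescribed gradients are a definite distance apart. -/
theorem exists_pos_le_gap (hC : IsCompact C) (hfc : Continuous f) (hG : Continuous G)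
    (hf : ∀ x y : C, inner ℝ (G y) ((x : E) - y) ≤ f x - f y)
    (hfG : ∀ x y : C, f x - f y = inner ℝ (G y) ((x : E) - y) → G x = G y) {ε : ℝ} (hε : 0 < ε) :
    ∃ δ > 0, ∀ y z : C, ε ≤ ‖G y - G z‖ → δ ≤ f y - f z - inner ℝ (G z) ((y : E) - z) := by
  have : CompactSpace C := isCompact_iff_compactSpace.1 hC
  have hS : IsCompact {p : C × C | ε ≤ ‖G p.1 - G p.2‖} :=
    (isClosed_le continuous_const (by fun_prop)).isCompact
  rcases Set.eq_empty_or_nonempty {p : C × C | ε ≤ ‖G p.1 - G p.2‖} with he | hne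
  · refine ⟨1, one_pos, fun y z h ↦ ?_⟩
    have : (y, z) ∈ {p : C × C | ε ≤ ‖G p.1 - G p.2‖} := h
    simp [he] at this
  obtain ⟨p, hp, hmin⟩ := hS.exists_isMinOn hne
    (f := fun p : C × C ↦ f p.1 - f p.2 - inner ℝ (G p.2) ((p.1 : E) - p.2))
    (by fun_prop)
  refine ⟨_, ?_, fun y z h ↦ hmin (show (y, z) ∈ {p : C × C | ε ≤ ‖G p.1 - G p.2‖} from h)⟩
  refine lt_of_le_of_ne (sub_nonneg.2 (hf p.1 p.2)) fun h ↦ ?_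
  have hp' : ε ≤ ‖G p.1 - G p.2‖ := hp
  rw [hfG p.1 p.2 (sub_eq_zero.1 h.symm), sub_self, norm_zero] at hp'
  linarith

/-- The affine functions `x ↦ f z + ⟪G z, x - z⟫` lie below `x ↦ f y + ⟪G y, x - y⟫ + Φ (x - y)`
for a suitable uniformly smooth `Φ` which vanishes at the origin. -/
theorem exists_barrier (hC : IsCompact C) (hG : Continuous G) (hM0 : 0 ≤ M)
    (hM : ∀ y, ‖G y‖ ≤ M) (hf : ∀ x y : C, inner ℝ (G y) ((x : E) - y) ≤ f x - f y)
    (hfG : ∀ x y : C, f x - f y = inner ℝ (G y) ((x : E) - y) → G x = G y) :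
    ∃ Φ : E → ℝ, Φ 0 = 0 ∧ UniformlySmooth Φ ∧ (∀ x y, Φ x ≤ Φ y + 20 * M * ‖x - y‖) ∧
      ∀ (y z : C) (x : E),
        f z + inner ℝ (G z) (x - z) ≤ f y + inner ℝ (G y) (x - y) + Φ (x - y) := by
  have hGG (y z : C) : ‖G y - G z‖ ≤ 2 * M := by
    linarith [norm_sub_le (G y) (G z), hM y, hM z]
  have hcauchy (y z : C) (p : E) : -(‖G y - G z‖ * ‖p‖) ≤ inner ℝ (G y - G z) p :=
    (neg_le_neg (abs_real_inner_le_norm _ _)).trans (neg_abs_le _)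
  -- If `G y` and `G z` are far apart, the compactness gap absorbs the inner product for small `p`;
  -- if they are close, the inner product is itself small.
  have hscale (k : ℕ) : ∃ δ > 0, δ ≤ (1 / 2 : ℝ) ^ k ∧ ∀ (y z : C) (p : E), ‖p‖ ≤ δ →
      0 ≤ f y - f z - inner ℝ (G z) ((y : E) - z) + inner ℝ (G y - G z) p
        + 2 * M * (1 / 2) ^ k * ‖p‖ := by
    rcases hM0.eq_or_lt with rfl | hMpos
    · refine ⟨(1 / 2) ^ k, by positivity, le_rfl, fun y z p _ ↦ ?_⟩
      have h₁ : G y - G z = 0 := norm_le_zero_iff.1 (by simpa using hGG y z)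
      rw [h₁, inner_zero_left]
      linarith [hf y z]
    · obtain ⟨η, hη, H⟩ := exists_pos_le_gap hC (continuous_of_subgradient_bounded hM hf) hG hf hfG
        (ε := 2 * M * (1 / 2) ^ k) (by positivity)
      refine ⟨min ((1 / 2) ^ k) (η / (2 * M)), by positivity, min_le_left _ _, fun y z p hp ↦ ?_⟩
      have h₁ := hcauchy y z p
      have h₀ := norm_nonneg p
      rcases le_total (2 * M * (1 / 2) ^ k) ‖G y - G z‖ with hbig | hsmall
      · have h₂ : 2 * M * ‖p‖ ≤ η := by
          have := (le_div_iff₀ (by positivity)).1 (hp.trans (min_le_right _ _))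
          linarith
        have h₃ := mul_le_mul_of_nonneg_right (hGG y z) h₀
        have h₄ : 0 ≤ 2 * M * (1 / 2) ^ k * ‖p‖ := by positivity
        linarith [H y z hbig]
      · have h₂ := mul_le_mul_of_nonneg_right hsmall h₀
        linarith [hf y z]
  choose d hd hdk H using hscale
  refine ⟨fun x ↦ 10 * M * softNormSum d x, by simp [softNormSum_zero hd],
    (uniformlySmooth_softNormSum hd).const_mul (by positivity), fun x y ↦ ?_, fun y z x ↦ ?_⟩
  · have := mul_le_mul_of_nonneg_left (softNormSum_le_add hd x y)
      (show 0 ≤ 10 * M by positivity)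
    linarith
  set p := x - (y : E) with hp
  suffices h : 0 ≤ f y - f z - inner ℝ (G z) ((y : E) - z) + inner ℝ (G y - G z) p
      + 10 * M * softNormSum d p by
    have h₁ : x - z = p + ((y : E) - z) := by rw [hp]; abel
    rw [inner_sub_left] at h
    rw [h₁, inner_add_right]
    linarith
  rcases eq_or_ne p 0 with h0 | h0
  · rw [h0, softNormSum_zero hd, inner_zero_right]
    linarith [hf y z]
  have hpos : 0 < ‖p‖ := norm_pos_iff.2 h0
  have hex : ∃ N, d N < ‖p‖ := by
    obtain ⟨N, hN⟩ := exists_pow_lt_of_lt_one hpos (show (1 / 2 : ℝ) < 1 by norm_num)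
    exact ⟨N, (hdk N).trans_lt hN⟩
  classical
  have hN := norm_le_softNormSum hd (Nat.find_spec hex).le
  -- With `N = m + 1` the first scale below `‖p‖`, the estimate at scale `m` needs `2 * M * (1 / 2)
  -- ^ m * ‖p‖`, which is exactly `10 * M * (1 / 2) ^ (m + 1) * (2 / 5) * ‖p‖`.
  rcases hfind : Nat.find hex with _ | m
  · rw [hfind, pow_zero, one_mul] at hN
    have h₁ := mul_le_mul_of_nonneg_left hN (show 0 ≤ 10 * M by positivity)
    have h₂ := mul_le_mul_of_nonneg_right (hGG y z) hpos.le
    have h₃ : 0 ≤ M * ‖p‖ := by positivity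
    linarith [hcauchy y z p, hf y z]
  · have hm : ‖p‖ ≤ d m := not_lt.1 (Nat.find_min hex (by omega))
    rw [hfind, pow_succ] at hN
    have h₁ := mul_le_mul_of_nonneg_left hN (show 0 ≤ 10 * M by positivity)
    linarith [H m y z p hm]

theorem exists_convex_extension [CompleteSpace E] (hC : IsCompact C) (hne : C.Nonempty)
    (hG : Continuous G) (hM : ∀ y, ‖G y‖ ≤ M)
    (hf : ∀ x y : C, inner ℝ (G y) ((x : E) - y) ≤ f x - f y)
    (hfG : ∀ x y : C, f x - f y = inner ℝ (G y) ((x : E) - y) → G x = G y) :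
    ∃ F : E → ℝ, ConvexOn ℝ Set.univ F ∧ ContDiff ℝ 1 F ∧ (∀ y : C, F y = f y) ∧
      (∀ y : C, HasGradientAt F (G y) (y : E)) ∧ ∀ x y, F x ≤ F y + 21 * M * ‖x - y‖ := by
  have : Nonempty C := hne.to_subtype
  let y₀ : C := Classical.arbitrary C
  have hM0 : 0 ≤ M := (norm_nonneg _).trans (hM y₀)
  obtain ⟨Φ, hΦ0, hΦs, hΦL, hΦ⟩ := exists_barrier hC hG hM0 hM hf hfG
  let ψ (y : C) (x : E) : ℝ := f y + inner ℝ (G y) (x - y) + Φ (x - y)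
  let g (x : E) : ℝ := ⨅ y, ψ y x
  have hg_le (y : C) (x : E) : g x ≤ ψ y x :=
    ciInf_le ⟨f y₀ + inner ℝ (G y₀) (x - y₀), by rintro _ ⟨z, rfl⟩; exact hΦ z y₀ x⟩ y
  have hg_ge (z : C) (x : E) : f z + inner ℝ (G z) (x - z) ≤ g x := le_ciInf fun y ↦ hΦ y z x
  have haff (z : C) : ConvexOn ℝ Set.univ fun x ↦ f z + inner ℝ (G z) (x - z) := by
    have := ((InnerProductSpace.toDual ℝ E (G z)).toLinearMap.convexOn
      convex_univ).add_const (f z - inner ℝ (G z) (z : E))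
    refine this.congr fun x _ ↦ ?_
    simp only [Pi.add_apply, ContinuousLinearMap.coe_coe, InnerProductSpace.toDual_apply_apply,
      inner_sub_right]
    ring
  have hgs : UniformlySmooth g := by
    intro ε hε
    obtain ⟨δ, hδ, H⟩ := hΦs ε hε
    refine ⟨δ, hδ, fun x h hh ↦ ?_⟩
    have : (g (x + h) + g (x - h) - ε * ‖h‖) / 2 ≤ g x := le_ciInf fun y ↦ ?_
    · linarith
    have h₁ := hg_le y (x + h)
    have h₂ := hg_le y (x - h)
    have h₃ := H (x - y) h hh
    simp only [ψ] at h₁ h₂ ⊢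
    rw [add_sub_right_comm, inner_add_right] at h₁
    rw [sub_right_comm, inner_sub_right _ _ h] at h₂
    linarith
  have hgL (x y : E) : g x ≤ g y + 21 * M * ‖x - y‖ := by
    have : g x - 21 * M * ‖x - y‖ ≤ g y := le_ciInf fun z ↦ ?_
    · linarith
    have h₁ := hg_le z x
    have h₂ := hΦL (x - z) (y - z)
    have h₃ := (real_inner_le_norm (G z) (x - y)).trans
      (mul_le_mul_of_nonneg_right (hM z) (norm_nonneg _))
    have h₄ : inner ℝ (G z) (x - z) = inner ℝ (G z) (y - z) + inner ℝ (G z) (x - y) := by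
      rw [← inner_add_right]
      congr 1
      abel
    rw [sub_sub_sub_cancel_right] at h₂
    simp only [ψ] at h₁ ⊢
    linarith
  have hFconv := convexOn_convexMinorant (haff y₀) (hg_ge y₀)
  have hFL := convexMinorant_le_add hgL (haff y₀) (hg_ge y₀)
  have hFs := hgs.convexMinorant (haff y₀) (hg_ge y₀)
  have hFc : Continuous (convexMinorant g) :=
    (LipschitzWith.of_le_add_mul (21 * M).toNNReal fun x y ↦ by
      rw [Real.coe_toNNReal _ (by positivity), dist_eq_norm]
      exact hFL x y).continuous
  have hFg := convexMinorant_le (haff y₀) (hg_ge y₀)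
  have hlow (z : C) (x : E) : f z + inner ℝ (G z) (x - z) ≤ convexMinorant g x :=
    le_convexMinorant (haff z) (hg_ge z) x
  have hFf (y : C) : convexMinorant g y = f y := by
    refine le_antisymm ?_ (by simpa using hlow y y)
    simpa [ψ, hΦ0] using (hFg y).trans (hg_le y y)
  refine ⟨convexMinorant g, hFconv, hFs.contDiff hFconv hFc, hFf, fun y ↦ ?_, hFL⟩
  have hlow' (z : E) : convexMinorant g y + inner ℝ (G y) (z - y) ≤ convexMinorant g z := by
    rw [hFf y]
    exact hlow y z
  refine hasGradientAt_of_sandwich hlow' fun ε hε ↦ ?_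
  obtain ⟨δ, hδ, H⟩ := hFs ε hε
  exact ⟨δ, hδ, fun h hh ↦ le_add_inner_of_second_difference_le hlow' (H y h hh)⟩

end Extension

theorem theorem1p10 (n : ℕ) :
    ∃ k : ℝ≥0, 1 ≤ k ∧
      ∀ (C : Set (EuclideanSpace ℝ (Fin n))), IsCompact C →
      ∀ (f : C → ℝ) (G : C → EuclideanSpace ℝ (Fin n)), Continuous G →
        ((∃ F : EuclideanSpace ℝ (Fin n) → ℝ, IsConvexC1Extension f G F) ↔
          (CondC f G ∧ CondCW1 f G)) ∧
        (CondC f G ∧ CondCW1 f G →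
          ∃ F : EuclideanSpace ℝ (Fin n) → ℝ, IsConvexC1Extension f G F ∧
            LipschitzWith (k * ⨆ y : C, ‖G y‖₊) F) := by
  refine ⟨21, by norm_num, fun C hC f G hG ↦ ?_⟩
  have hext : CondC f G ∧ CondCW1 f G →
      ∃ F : EuclideanSpace ℝ (Fin n) → ℝ, IsConvexC1Extension f G F ∧
        LipschitzWith (21 * ⨆ y : C, ‖G y‖₊) F := by
    rintro ⟨hf, hfG⟩
    -- On the empty set there is no tangent to bound `g` from below, so the zero function is used.
    rcases C.eq_empty_or_nonempty with rfl | hne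
    · exact ⟨fun _ ↦ 0, ⟨convexOn_const 0 convex_univ, contDiff_const, fun y ↦ y.2.elim,
        fun y ↦ y.2.elim⟩, (LipschitzWith.const (0 : ℝ)).weaken zero_le⟩
    have : CompactSpace C := isCompact_iff_compactSpace.1 hC
    have hbdd : BddAbove (Set.range fun y : C ↦ ‖G y‖₊) :=
      (isCompact_range (by fun_prop)).bddAbove
    obtain ⟨F, h₁, h₂, h₃, h₄, h₅⟩ := exists_convex_extension
      (M := ((⨆ y : C, ‖G y‖₊ : ℝ≥0) : ℝ)) hC hne hG
      (fun y ↦ NNReal.coe_le_coe.2 (le_ciSup hbdd y)) (fun x y ↦ hf x y) hfG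
    refine ⟨F, ⟨h₁, h₂, h₃, h₄⟩, LipschitzWith.of_le_add_mul _ fun x y ↦ ?_⟩
    rw [dist_eq_norm]
    exact_mod_cast h₅ x y
  refine ⟨⟨?_, fun h ↦ (hext h).imp fun F hF ↦ hF.1⟩, hext⟩
  rintro ⟨F, hF⟩
  refine ⟨fun x y ↦ ?_, fun x y h ↦ ?_⟩
  · have := hF.convexOn.add_inner_le_of_hasGradientAt (hF.hasGradientAt y) x
    rw [hF.eq_on, hF.eq_on] at this
    linarith
  · refine hF.convexOn.gradient_eq_of_eq_add_inner (hF.hasGradientAt x) (hF.hasGradientAt y) ?_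
    rw [hF.eq_on, hF.eq_on]
    linarith
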